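/- Let $\mathcal{A}$ be a unital $C^*$-algebra, $\mathcal{H}$ a complex Hilbert space and $\mathscr{B}(\mathcal{H})$ the algebra of bounded operators on $\mathcal{H}$; CP means completely positive (and linear). By Stinespring's theorem every CP map $\varphi:\mathcal{A}\to\mathscr{B}(\mathcal{H})$ has a minimal Stinespring triple $(\mathcal{K},\pi,V)$, unique up to unitary equivalence: $\mathcal{K}$ is a complex Hilbert space, $\pi:\mathcal{A}\to\mathscr{B}(\mathcal{K})$ is a unital $*$-representation, $V:\mathcal{H}\to\mathcal{K}$ is bounded linear, $\varphi(X)=V^*\pi(X)V$ for all $X\in\mathcal{A}$, and $\overline{\mathrm{span}}\{\pi(X)Vh : X\in\mathcal{A},\ h\in\mathcal{H}\}=\mathcal{K}$. The CP map $\varphi$ is called quasi-pure if $\overline{\mathrm{span}}\{\pi(X)g : X\in\mathcal{A}\}=\mathcal{K}$ for every non-zero vector $g$ in the range of $V$. A CP map $\alpha:\mathcal{A}\to\mathscr{B}(\mathcal{H})$ is said to be dominated by $\varphi$ if $\varphi-\alpha$ is CP. **Corollary.** If $\varphi:\mathcal{A}\to\mathscr{B}(\mathcal{H})$ is a quasi-pure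 CP map and $\alpha:\mathcal{A}\to\mathscr{B}(\mathcal{H})$ is a CP map dominated by $\varphi$, then $\alpha$ is quasi-pure. -/

import Mathlib

open scoped CStarAlgebra

universe u v w

/-- `ψ` is dominated by `φ` (written `ψ ≤ φ`): the difference `φ - ψ` is completely positive. -/
def CPDominatedBy {A : Type u} {B : Type v}
    [NonUnitalCStarAlgebra A] [PartialOrder A] [StarOrderedRing A]
    [NonUnitalCStarAlgebra B] [PartialOrder B] [StarOrderedRing B]
    (ψ φ : A →CP B) : Prop :=
  ∃ δ : A →CP B, ∀ X : A, δ X = φ X - ψ X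

/-- `g` is a cyclic vector of the representation `π`: the closed linear span of
`{π(X) g : X ∈ A}` is the whole space. -/
def IsCyclicVector {A : Type u} [CStarAlgebra A]
    {K : Type w} [NormedAddCommGroup K] [InnerProductSpace ℂ K] [CompleteSpace K]
    (π : A →⋆ₐ[ℂ] (K →L[ℂ] K)) (g : K) : Prop :=
  (Submodule.span ℂ (Set.range fun X : A => π X g)).topologicalClosure = ⊤

/-- `(K, π, V)` is a Stinespring triple of `φ`: `π` is a unital `*`-representation of `A` on the
Hilbert space `K`, `V : H → K` is bounded linear, and `φ(X) = V* π(X) V` for all `X`. -/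
def IsStinespringTriple {A : Type u} [CStarAlgebra A] [PartialOrder A] [StarOrderedRing A]
    {H : Type v} [NormedAddCommGroup H] [InnerProductSpace ℂ H] [CompleteSpace H]
    {K : Type w} [NormedAddCommGroup K] [InnerProductSpace ℂ K] [CompleteSpace K]
    (φ : A →CP (H →L[ℂ] H)) (π : A →⋆ₐ[ℂ] (K →L[ℂ] K)) (V : H →L[ℂ] K) : Prop :=
  ∀ X : A, φ X = (ContinuousLinearMap.adjoint V).comp ((π X).comp V)

/-- A Stinespring triple is minimal if `{π(X) V h : X ∈ A, h ∈ H}` has closed linear span `K`. -/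
def IsMinimalStinespringTriple
    {A : Type u} [CStarAlgebra A] [PartialOrder A] [StarOrderedRing A]
    {H : Type v} [NormedAddCommGroup H] [InnerProductSpace ℂ H] [CompleteSpace H]
    {K : Type w} [NormedAddCommGroup K] [InnerProductSpace ℂ K] [CompleteSpace K]
    (φ : A →CP (H →L[ℂ] H)) (π : A →⋆ₐ[ℂ] (K →L[ℂ] K)) (V : H →L[ℂ] K) : Prop :=
  IsStinespringTriple φ π V ∧
    (Submodule.span ℂ (Set.range fun p : A × H => π p.1 (V p.2))).topologicalClosure = ⊤

/-- A CP map `φ : A → B(H)` is quasi-pure if, for its minimal Stinespring triple `(K, π, V)`, every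
non-zero vector in the range of `V` is cyclic for `π`.

The minimal triple exists and is unique up to unitary equivalence, and the condition is invariant
under unitary equivalence, so it does not matter which minimal triple is used. The space `K` is a
completion of a quotient of `A ⊗ H`, so it can be taken in the universe `max u v`. -/
def IsQuasiPure {A : Type u} [CStarAlgebra A] [PartialOrder A] [StarOrderedRing A]
    {H : Type v} [NormedAddCommGroup H] [InnerProductSpace ℂ H] [CompleteSpace H]
    (φ : A →CP (H →L[ℂ] H)) : Prop :=
  ∃ (K : Type (max u v)) (_ : NormedAddCommGroup K) (_ : InnerProductSpace ℂ K)
    (_ : CompleteSpace K) (π : A →⋆ₐ[ℂ] (K →L[ℂ] K)) (V : H →L[ℂ] K),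
    IsMinimalStinespringTriple φ π V ∧ ∀ g ∈ Set.range V, g ≠ 0 → IsCyclicVector π g

open scoped InnerProductSpace ComplexConjugate

/-! A Radon–Nikodym argument gives α(X) = V* D π(X) V with D ≥ 0 commuting with π(A): the kernel ⟨h,
α(X*Y) k⟩ on A × H is positive and dominated by the Gram kernel of the total family π(X)Vh, so it is
implemented by a positive operator D. Put S = √D and let M be the closure of the range of S. Since S
also commutes with π(A), M is invariant and SV : H → M, with π restricted to M, is a Stinespring
pair for α. As S intertwines the two representations and has dense range in M, it carries total sets
of K to total sets of M. This gives minimality and, since SVh ≠ 0 forces Vh ≠ 0, cyclicity of SVh.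
-/

/-- The sesquilinear form on finitely supported functions given by the kernel `k`. -/
noncomputable def kernelForm {P : Type*} (k : P → P → ℂ) (f g : P →₀ ℂ) : ℂ :=
  f.sum fun p a => g.sum fun q b => conj a * b * k p q

/-- A hermitian positive semidefinite kernel defines a pre-inner product on finitely supported
functions. -/
@[reducible]
noncomputable def kernelCore {P : Type*} (k : P → P → ℂ) (hsymm : ∀ p q, conj (k q p) = k p q)
    (hnonneg : ∀ c, 0 ≤ (kernelForm k c c).re) : PreInnerProductSpace.Core ℂ (P →₀ ℂ) where
  inner := kernelForm k
  conj_inner_symm f g := by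
    simp only [kernelForm, Finsupp.sum, map_sum, map_mul, hsymm, Complex.conj_conj]
    rw [Finset.sum_comm]
    exact Finset.sum_congr rfl fun p _ => Finset.sum_congr rfl fun q _ => by ring
  re_inner_nonneg := hnonneg
  add_left f f' g := by
    refine Finsupp.sum_add_index' (fun p => by simp) fun p a b => ?_
    simp [add_mul]
  smul_left f g r := by
    rw [kernelForm, Finsupp.sum_smul_index' (fun p => by simp), kernelForm, Finsupp.mul_sum]
    refine Finsupp.sum_congr fun p _ => ?_
    rw [Finsupp.mul_sum]
    exact Finsupp.sum_congr fun q _ => by simp [mul_assoc]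

/-- A positive semidefinite kernel dominated by the Gram kernel of a total family `e` is the
kernel of a positive operator. -/
theorem exists_isPositive_inner_eq_kernel {P : Type*} {K : Type*} [NormedAddCommGroup K]
    [InnerProductSpace ℂ K] [CompleteSpace K] (e : P → K)
    (he : (Submodule.span ℂ (Set.range e)).topologicalClosure = ⊤) (k : P → P → ℂ)
    (hsymm : ∀ p q, conj (k q p) = k p q) (hnonneg : ∀ c, 0 ≤ (kernelForm k c c).re)
    (hle : ∀ c, (kernelForm k c c).re ≤ ‖Finsupp.linearCombination ℂ e c‖ ^ 2) :
    ∃ D : K →L[ℂ] K, D.IsPositive ∧ ∀ p q, ⟪e p, D (e q)⟫_ℂ = k p q := by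
  let core := kernelCore k hsymm hnonneg
  let _ : SeminormedAddCommGroup (P →₀ ℂ) :=
    InnerProductSpace.Core.toSeminormedAddCommGroup (c := core)
  let _ : InnerProductSpace ℂ (P →₀ ℂ) := InnerProductSpace.ofCore core
  let j : (P →₀ ℂ) →ₗ[ℂ] UniformSpace.Completion (P →₀ ℂ) :=
    (UniformSpace.Completion.toComplₗᵢ (𝕜 := ℂ) (E := P →₀ ℂ)).toLinearMap
  let L := Finsupp.linearCombination ℂ e
  have hL : DenseRange L := by
    have := (Submodule.dense_iff_topologicalClosure_eq_top).2 he
    rwa [← Finsupp.range_linearCombination] at this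
  -- Domination makes `j` factor through `L` as a contraction, which extends to `T` on `K`; the
  -- operator sought is T*T.
  have hj : ∀ c, ‖j c‖ ≤ 1 * ‖L c‖ := fun c => by
    rw [one_mul]
    refine le_of_sq_le_sq ?_ (norm_nonneg _)
    have h1 : ‖j c‖ = ‖c‖ := UniformSpace.Completion.norm_coe c
    rw [h1, ← inner_self_eq_norm_sq (𝕜 := ℂ) c]
    exact hle c
  let T := j.extendOfNorm L
  have hT : ∀ c, T (L c) = j c := LinearMap.extendOfNorm_eq hL ⟨1, hj⟩
  refine ⟨T.adjoint ∘L T, T.isPositive_adjoint_comp_self, fun p q => ?_⟩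
  have h (p : P) : T (e p) = j (Finsupp.single p 1) := by
    rw [← hT]; simp [L]
  rw [ContinuousLinearMap.comp_apply, ContinuousLinearMap.adjoint_inner_right, h, h]
  refine (UniformSpace.Completion.inner_coe _ _).trans ?_
  change kernelForm k _ _ = _
  simp [kernelForm]

/-- The compression of a representation to an invariant subspace. -/
noncomputable def StarAlgHom.restrictInvariant {A : Type*} [CStarAlgebra A]
    {K : Type*} [NormedAddCommGroup K] [InnerProductSpace ℂ K] [CompleteSpace K]
    (π : A →⋆ₐ[ℂ] (K →L[ℂ] K)) (M : Submodule ℂ K) [CompleteSpace M]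
    (hM : ∀ X, ∀ x ∈ M, π X x ∈ M) : A →⋆ₐ[ℂ] (M →L[ℂ] M) where
  toFun X := ((π X).comp M.subtypeL).codRestrict M fun x => hM X x x.2
  map_one' := by ext; simp
  map_mul' X Y := by
    ext x
    exact congr($(map_mul π X Y) x)
  map_zero' := by ext; simp
  map_add' X Y := by
    ext x
    exact congr($(map_add π X Y) x)
  commutes' r := by ext; simp [Algebra.algebraMap_eq_smul_one]
  map_star' X := by
    rw [ContinuousLinearMap.star_eq_adjoint, ContinuousLinearMap.eq_adjoint_iff]
    intro x y
    change ⟪π (star X) x, (y : K)⟫_ℂ = ⟪(x : K), π X y⟫_ℂ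
    rw [map_star, ContinuousLinearMap.star_eq_adjoint, ContinuousLinearMap.adjoint_inner_left]

section CompletelyPositive

variable {A : Type u} [CStarAlgebra A] [PartialOrder A] [StarOrderedRing A]
  {H : Type v} [NormedAddCommGroup H] [InnerProductSpace ℂ H] [CompleteSpace H]

theorem NonUnitalCStarAlgebra.exists_eq_star_mul_self {B : Type*} [NonUnitalCStarAlgebra B]
    [PartialOrder B] [StarOrderedRing B] {b : B} (hb : 0 ≤ b) : ∃ c, b = star c * c :=
  CStarAlgebra.nonneg_iff_eq_star_mul_self.1 hb

/-- The matrix is C*C, where C has the row (a_j) at one chosen index and zeros elsewhere. -/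
theorem CStarMatrix.ofMatrix_star_mul_nonneg {n : Type*} [Fintype n] (a : n → A) :
    0 ≤ CStarMatrix.ofMatrix (Matrix.of fun i j : n => star (a i) * a j) := by
  classical
  rcases isEmpty_or_nonempty n with hn | ⟨⟨l⟩⟩
  · exact le_of_eq (CStarMatrix.ext fun i => isEmptyElim i)
  · let C : CStarMatrix n n A := CStarMatrix.ofMatrix (Matrix.of fun i j => if i = l then a j else 0)
    convert star_mul_self_nonneg C
    ext i j
    rw [CStarMatrix.mul_apply, Finset.sum_eq_single l]
    · simp [C, CStarMatrix.star_apply]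
    · intro b _ hb
      simp [C, hb]
    · simp

/-- Writing M = N*N turns the double sum into ∑ₗ ‖∑ᵢ Nₗᵢ hᵢ‖². -/
theorem CStarMatrix.sum_inner_re_nonneg {n : Type*} [Fintype n]
    {M : CStarMatrix n n (H →L[ℂ] H)} (hM : 0 ≤ M) (h : n → H) :
    0 ≤ (∑ i, ∑ j, ⟪h i, M i j (h j)⟫_ℂ).re := by
  obtain ⟨N, rfl⟩ := NonUnitalCStarAlgebra.exists_eq_star_mul_self hM
  have key : ∑ i, ∑ j, ⟪h i, (star N * N) i j (h j)⟫_ℂ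
      = ∑ l, ⟪∑ i, N l i (h i), ∑ j, N l j (h j)⟫_ℂ := by
    simp only [CStarMatrix.mul_apply, CStarMatrix.star_apply, sum_inner, inner_sum,
      sum_apply, mul_apply_eq_comp,
      ContinuousLinearMap.star_eq_adjoint, ContinuousLinearMap.adjoint_inner_right]
    have (f : n → n → n → ℂ) : ∑ i, ∑ j, ∑ l, f i j l = ∑ l, ∑ j, ∑ i, f i j l := by
      rw [Finset.sum_comm, Finset.sum_comm_cycle]
    rw [this]
  rw [key, Complex.re_sum]
  exact Finset.sum_nonneg fun l _ => inner_self_nonneg (𝕜 := ℂ)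

/-- The kernel on `A × H` of a map `ψ : A → B(H)`. -/
noncomputable def stinespringKernel (ψ : A →CP (H →L[ℂ] H)) (p q : A × H) : ℂ :=
  ⟪p.2, ψ (star p.1 * q.1) q.2⟫_ℂ

theorem conj_stinespringKernel (ψ : A →CP (H →L[ℂ] H)) (p q : A × H) :
    conj (stinespringKernel ψ q p) = stinespringKernel ψ p q := by
  have : star p.1 * q.1 = star (star q.1 * p.1) := by simp
  rw [stinespringKernel, stinespringKernel, inner_conj_symm, this, map_star,
    ContinuousLinearMap.star_eq_adjoint, ContinuousLinearMap.adjoint_inner_right]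

theorem kernelForm_stinespringKernel_nonneg (ψ : A →CP (H →L[ℂ] H)) (c : A × H →₀ ℂ) :
    0 ≤ (kernelForm (stinespringKernel ψ) c c).re := by
  -- The scalar coefficients are absorbed into the vectors of H.
  have := CStarMatrix.sum_inner_re_nonneg (ψ.map_cstarMatrix_nonneg _
    (CStarMatrix.ofMatrix_star_mul_nonneg fun i : c.support => i.1.1))
    fun i => c i • i.1.2
  convert this using 2
  rw [kernelForm, Finsupp.sum, ← Finset.sum_coe_sort]
  refine Finset.sum_congr rfl fun i _ => ?_
  rw [Finsupp.sum, ← Finset.sum_coe_sort]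
  refine Finset.sum_congr rfl fun j _ => ?_
  change _ = ⟪c i • i.1.2, ψ (star i.1.1 * j.1.1) (c j • j.1.2)⟫_ℂ
  rw [map_smul, inner_smul_left, inner_smul_right, stinespringKernel, mul_assoc]

theorem IsStinespringTriple.stinespringKernel_eq
    {K : Type w} [NormedAddCommGroup K] [InnerProductSpace ℂ K] [CompleteSpace K]
    {φ : A →CP (H →L[ℂ] H)} {π : A →⋆ₐ[ℂ] (K →L[ℂ] K)} {V : H →L[ℂ] K}
    (h : IsStinespringTriple φ π V) (p q : A × H) :
    stinespringKernel φ p q = ⟪π p.1 (V p.2), π q.1 (V q.2)⟫_ℂ := by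
  rw [stinespringKernel, h]
  simp [map_star, ContinuousLinearMap.star_eq_adjoint, ContinuousLinearMap.adjoint_inner_right]

theorem IsStinespringTriple.kernelForm_eq
    {K : Type w} [NormedAddCommGroup K] [InnerProductSpace ℂ K] [CompleteSpace K]
    {φ : A →CP (H →L[ℂ] H)} {π : A →⋆ₐ[ℂ] (K →L[ℂ] K)} {V : H →L[ℂ] K}
    (h : IsStinespringTriple φ π V) (c : A × H →₀ ℂ) :
    (kernelForm (stinespringKernel φ) c c).re
      = ‖Finsupp.linearCombination ℂ (fun p : A × H => π p.1 (V p.2)) c‖ ^ 2 := by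
  rw [← inner_self_eq_norm_sq (𝕜 := ℂ), Finsupp.linearCombination_apply, Finsupp.sum, kernelForm,
    Finsupp.sum, sum_inner]
  congr 1
  refine Finset.sum_congr rfl fun p _ => ?_
  rw [Finsupp.sum, inner_sum]
  refine Finset.sum_congr rfl fun q _ => ?_
  rw [h.stinespringKernel_eq, inner_smul_left, inner_smul_right]
  ring

/-- Radon–Nikodym theorem for completely positive maps. -/
theorem IsMinimalStinespringTriple.exists_isPositive_commute
    {K : Type w} [NormedAddCommGroup K] [InnerProductSpace ℂ K] [CompleteSpace K]
    {φ α : A →CP (H →L[ℂ] H)} {π : A →⋆ₐ[ℂ] (K →L[ℂ] K)} {V : H →L[ℂ] K}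
    (h : IsMinimalStinespringTriple φ π V) (hα : CPDominatedBy α φ) :
    ∃ D : K →L[ℂ] K, D.IsPositive ∧ (∀ X, Commute D (π X)) ∧
      ∀ X, α X = V.adjoint ∘L (D * π X) ∘L V := by
  obtain ⟨δ, hδ⟩ := hα
  let e : A × H → K := fun p => π p.1 (V p.2)
  obtain ⟨D, hD, hDe⟩ := exists_isPositive_inner_eq_kernel e h.2 (stinespringKernel α)
    (conj_stinespringKernel α) (kernelForm_stinespringKernel_nonneg α) fun c => by
      rw [← h.1.kernelForm_eq]
      have : kernelForm (stinespringKernel δ) c c =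
          kernelForm (stinespringKernel φ) c c - kernelForm (stinespringKernel α) c c := by
        simp only [kernelForm, Finsupp.sum, stinespringKernel, hδ, sub_apply,
          inner_sub_right, mul_sub, Finset.sum_sub_distrib]
      have h2 := kernelForm_stinespringKernel_nonneg δ c
      rw [this, Complex.sub_re] at h2
      linarith
  have hdense : Dense (Submodule.span ℂ (Set.range e) : Set K) :=
    Submodule.dense_iff_topologicalClosure_eq_top.2 h.2
  refine ⟨D, hD, fun X => ?_, fun X => ?_⟩
  · refine ContinuousLinearMap.ext_on hdense ?_
    rintro _ ⟨q, rfl⟩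
    have hL : DenseRange (Finsupp.linearCombination ℂ e) := by
      rwa [← Finsupp.range_linearCombination] at hdense
    refine hL.eq_of_inner_right ℂ fun c => ?_
    simp only [Finsupp.linearCombination_apply, Finsupp.sum, sum_inner, inner_smul_left]
    refine Finset.sum_congr rfl fun p _ => congrArg _ ?_
    have h1 : π X (e q) = e (X * q.1, q.2) := by simp [e]
    -- Moving X across the inner product turns both sides into the α-kernel with X in the middle.
    have h2 (x : K) : ⟪e p, π X x⟫_ℂ = ⟪e (star X * p.1, p.2), x⟫_ℂ := by
      simp [e, map_star, ContinuousLinearMap.star_eq_adjoint,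
        ContinuousLinearMap.adjoint_inner_left]
    rw [mul_apply_eq_comp, mul_apply_eq_comp, h1, h2, hDe, hDe]
    simp [stinespringKernel, mul_assoc]
  · ext x
    refine ext_inner_left ℂ fun y => ?_
    have := hDe (1, y) (X, x)
    simp only [e, stinespringKernel, map_one, one_apply_eq_self, star_one,
      one_mul] at this
    simp [ContinuousLinearMap.adjoint_inner_right, this]

end CompletelyPositive

theorem mainTheorem6
    {A : Type u} [CStarAlgebra A] [PartialOrder A] [StarOrderedRing A]
    {H : Type v} [NormedAddCommGroup H] [InnerProductSpace ℂ H] [CompleteSpace H]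
    (φ α : A →CP (H →L[ℂ] H)) (hφ : IsQuasiPure φ) (hα : CPDominatedBy α φ) :
    IsQuasiPure α := by
  obtain ⟨K, _, _, _, π, V, hV, hcyc⟩ := hφ
  obtain ⟨D, hD, hcomm, hαD⟩ := hV.exists_isPositive_commute hα
  let S := CFC.sqrt D
  have hD0 : 0 ≤ D := D.nonneg_iff_isPositive.2 hD
  have hSS : S * S = D := CFC.sqrt_mul_sqrt_self D hD0
  have hSadj : S.adjoint = S := (CFC.sqrt_nonneg D).isSelfAdjoint.star_eq
  -- Commutation with D passes to √D through the functional calculus.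
  have hS (X : A) (x : K) : π X (S x) = S (π X x) :=
    (congr($((hcomm X).cfcₙ_nnreal NNReal.sqrt) x) : (S * π X) x = (π X * S) x).symm
  let M := S.range.topologicalClosure
  have : CompleteSpace M := S.range.isClosed_topologicalClosure.completeSpace_coe
  have hM (X : A) (x : K) (hx : x ∈ M) : π X x ∈ M := by
    refine map_mem_closure (π X).continuous hx ?_
    rintro _ ⟨y, rfl⟩
    exact ⟨π X y, (hS X y).symm⟩
  let R : K →L[ℂ] M := S.codRestrict M fun x => subset_closure ⟨x, rfl⟩
  have hRdense : DenseRange R := by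
    rw [DenseRange, Subtype.dense_iff]
    intro x hx
    rw [← Set.range_comp]
    exact hx
  have hRπ (X : A) (x : K) : π.restrictInvariant M hM X (R x) = R (π X x) := Subtype.ext (hS X x)
  have hspan (s : Set K) (hs : (Submodule.span ℂ s).topologicalClosure = ⊤) :
      (Submodule.span ℂ (R '' s)).topologicalClosure = ⊤ := by
    rw [← Submodule.dense_iff_topologicalClosure_eq_top] at hs ⊢
    have := hRdense.dense_image R.continuous hs
    have hmap := Submodule.map_span R.toLinearMap s
    rw [SetLike.ext'_iff, Submodule.map_coe] at hmap
    exact hmap ▸ this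
  refine ⟨M, inferInstance, inferInstance, inferInstance, π.restrictInvariant M hM, R ∘L V,
    ⟨fun X => ?_, ?_⟩, ?_⟩
  · ext x
    refine ext_inner_left ℂ fun y => ?_
    simp only [ContinuousLinearMap.comp_apply, ContinuousLinearMap.adjoint_inner_right, hRπ, hαD]
    change _ = ⟪S (V y), S (π X (V x))⟫_ℂ
    rw [← hSadj, ContinuousLinearMap.adjoint_inner_left, hSadj, ← hSS]
    rfl
  · have := hspan _ hV.2
    rw [← Set.range_comp] at this
    simpa only [Function.comp_def, ContinuousLinearMap.comp_apply, hRπ] using this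
  · rintro _ ⟨x, rfl⟩ hx
    have hVx : V x ≠ 0 := fun h0 => hx (by simp [h0])
    have := hspan _ (hcyc (V x) ⟨x, rfl⟩ hVx)
    rw [← Set.range_comp] at this
    rw [IsCyclicVector]
    simpa only [Function.comp_def, ContinuousLinearMap.comp_apply, hRπ] using this
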